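/- All rings are associative with identity, and ``countable'' means finite or countably infinite. Let $R$ be a ring. A right coprime pair in $R$ is a pair $\langle a,b\rangle$ of elements with $aR+bR=R$, where $\langle a,b\rangle$ and $\langle a',b'\rangle$ are identified when $aR=a'R$ and $bR=b'R$. Right coprime pairs are partially ordered by $\langle a,b\rangle\le\langle a',b'\rangle$ if and only if $aR\subseteq a'R$ and $bR\subseteq b'R$. A compatible descending chain of right coprime pairs is a descending family $(p_\alpha)_{\alpha<\kappa}$, with $\kappa$ an ordinal, for which there are elements $a_\alpha,b_\alpha$ ($\alpha<\kappa$) with $p_\alpha=\langle a_\alpha,b_\alpha\rangle$ and elements $r_{\alpha\beta},s_{\alpha\beta}$ ($\alpha<\beta<\kappa$) of $R$ such that $$a_\beta=a_\alpha r_{\alpha\beta},\qquad b_\beta=b_\alpha s_{\alpha\beta}\qquad(\alpha<\beta<\kappa),$$ $$r_{\alpha\beta}=r_{\alpha\gamma}r_{\gamma\beta},\qquad s_{\alpha\beta}=s_{\alpha\gamma}s_{\gamma\beta}\qquad(\alpha<\gamma<\beta<\kappa).$$ The ring $R$ is right strongly exchange if for every compatible descending chain of right coprime pairs there is a lower bound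 of the chain that is a minimal element of the poset of all right coprime pairs. The ring $R$ is von Neumann regular if for every $a\in R$ there is $x\in R$ with $axa=a$. It is left continuous if the left module ${}_RR$ satisfies: (C1) every submodule is essential in a direct summand of ${}_RR$; and (C2) every submodule of ${}_RR$ isomorphic to a direct summand of ${}_RR$ is itself a direct summand of ${}_RR$. Corollary. 1. If $R$ is right strongly exchange, has countably many idempotents, and has zero Jacobson radical, then $R$ is semisimple. 2. In particular, if $R$ is von Neumann regular and left continuous and has countably many idempotents, then $R$ is semisimple. -/

import Mathlib

universe u v

section CoprimePairs

variable (R : Type u) [Ring R]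

variable {R} in
/-- The principal right ideal `aR`, as a submodule of the right module `R_R`. -/
def principalRightIdeal (a : R) : Submodule Rᵐᵒᵖ R :=
  Submodule.span Rᵐᵒᵖ {a}

variable {R} in
theorem mem_principalRightIdeal {a x : R} : x ∈ principalRightIdeal a ↔ ∃ r : R, x = a * r := by
  rw [principalRightIdeal, Submodule.mem_span_singleton]
  constructor
  · rintro ⟨r, rfl⟩
    exact ⟨r.unop, rfl⟩
  · rintro ⟨r, rfl⟩
    exact ⟨MulOpposite.op r, rfl⟩

/-- A pair of elements `a, b` of `R` with `aR + bR = R`. -/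
@[ext]
structure RightCoprimeGenerators where
  fst : R
  snd : R
  sup_eq_top : principalRightIdeal fst ⊔ principalRightIdeal snd = ⊤

/-- `(a, b) ≤ (a', b')` if and only if `aR ≤ a'R` and `bR ≤ b'R`. -/
instance RightCoprimeGenerators.instPreorder : Preorder (RightCoprimeGenerators R) :=
  Preorder.lift fun p => (principalRightIdeal p.fst, principalRightIdeal p.snd)

/-- The partially ordered set of right coprime pairs `⟨a, b⟩` of `R`: pairs of elements with
`aR + bR = R`, where `⟨a, b⟩ = ⟨a', b'⟩` if and only if `aR = a'R` and `bR = b'R`. -/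
abbrev RightCoprimePair : Type u :=
  Antisymmetrization (RightCoprimeGenerators R) (· ≤ ·)

/-- The class `⟨a, b⟩` of a pair of generators. -/
def RightCoprimeGenerators.toPair {R : Type u} [Ring R] (g : RightCoprimeGenerators R) :
    RightCoprimePair R :=
  toAntisymmetrization (· ≤ ·) g

theorem RightCoprimeGenerators.toPair_le_toPair {R : Type u} [Ring R]
    (g h : RightCoprimeGenerators R) :
    g.toPair ≤ h.toPair ↔ principalRightIdeal g.fst ≤ principalRightIdeal h.fst ∧
      principalRightIdeal g.snd ≤ principalRightIdeal h.snd :=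
  toAntisymmetrization_le_toAntisymmetrization_iff

theorem RightCoprimeGenerators.toPair_eq_toPair {R : Type u} [Ring R]
    (g h : RightCoprimeGenerators R) :
    g.toPair = h.toPair ↔ principalRightIdeal g.fst = principalRightIdeal h.fst ∧
      principalRightIdeal g.snd = principalRightIdeal h.snd := by
  rw [le_antisymm_iff, toPair_le_toPair, toPair_le_toPair, le_antisymm_iff, le_antisymm_iff]
  tauto

variable {R} in
/-- A compatible descending chain of right coprime pairs indexed by the ordinals below `κ`. -/
def IsCompatibleDescendingChain {κ : Ordinal.{u}} (p : Set.Iio κ → RightCoprimePair R) : Prop :=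
  Antitone p ∧
  ∃ (g : Set.Iio κ → RightCoprimeGenerators R) (r s : Set.Iio κ → Set.Iio κ → R),
    (∀ α, (g α).toPair = p α) ∧
    (∀ α β, α < β → (g β).fst = (g α).fst * r α β ∧ (g β).snd = (g α).snd * s α β) ∧
    (∀ α γ β, α < γ → γ < β → r α β = r α γ * r γ β ∧ s α β = s α γ * s γ β)

/-- Every compatible descending chain of right coprime pairs has a minimal lower bound: a lower
bound that is a minimal element of the poset of all right coprime pairs. -/
def IsRightStronglyExchange : Prop :=
  ∀ (κ : Ordinal.{u}) (p : Set.Iio κ → RightCoprimePair R), IsCompatibleDescendingChain p →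
    ∃ q : RightCoprimePair R, q ∈ lowerBounds (Set.range p) ∧ IsMin q

/-- Every element `a` satisfies `a = a * x * a` for some `x`. -/
def IsVonNeumannRegularRing : Prop :=
  ∀ a : R, ∃ x : R, a * x * a = a

end CoprimePairs

section Continuous

variable {R : Type u} [Ring R] {M : Type v} [AddCommGroup M] [Module R M]

/-- `K` is contained in `D` and meets every non-zero submodule of `D` non-trivially. -/
def IsEssentialIn (K D : Submodule R M) : Prop :=
  K ≤ D ∧ ∀ L : Submodule R M, L ≤ D → K ⊓ L = ⊥ → L = ⊥

variable (R M) in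
/-- A continuous left module: conditions (C1) and (C2); direct summands of `M` are the
submodules that have a complement. -/
structure IsContinuousModule : Prop where
  c1 : ∀ K : Submodule R M, ∃ D : Submodule R M, IsComplemented D ∧ IsEssentialIn K D
  c2 : ∀ K D : Submodule R M, IsComplemented D → Nonempty (K ≃ₗ[R] D) → IsComplemented K

variable (R) in
/-- `R` is continuous as a left module over itself. -/
def IsLeftContinuousRing : Prop :=
  IsContinuousModule R R

end Continuous

/-! ### Counting idempotents in rings that are not semisimple. -/

section Idempotents

variable {R : Type u} [Ring R]

/-! Both statements follow from one counting argument. If every nonzero left ideal contains a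
nonzero idempotent and `R` is not semisimple, then `R` has infinitely many nonzero orthogonal
idempotents `e i` (`exists_orthogonalIdempotents`). An idempotent `f S` is attached to each set `S`
of indices in such a way that it determines `S`, so there are uncountably many idempotents.

In the exchange case, a minimal pair yields a decomposition of `R` when the radical is zero
(`exists_idempotent_of_isMin`). A chain built from partial sums of the `e i` then gives `e i * f S =
e i` for `i ∈ S` and `e i * f S = 0` otherwise. In the continuous case, (C1) makes the sum of the `R
e_i`, `i ∈ S`, essential in a summand generated by `f S`. -/

/-- Every nonzero left ideal contains a nonzero idempotent. -/
def HasIdempotentMultiples (R : Type u) [Ring R] : Prop :=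
  ∀ x : R, x ≠ 0 → ∃ z : R, IsIdempotentElem (z * x) ∧ z * x ≠ 0

theorem isComplemented_span_singleton {f : R} (hf : IsIdempotentElem f) :
    IsComplemented (Ideal.span {f}) := by
  refine ⟨Ideal.span {1 - f}, ?_, ?_⟩
  · rw [Submodule.disjoint_def]
    intro x hx hx'
    obtain ⟨a, rfl⟩ := Ideal.mem_span_singleton'.1 hx
    obtain ⟨b, hb⟩ := Ideal.mem_span_singleton'.1 hx'
    calc a * f = a * f * f := by rw [mul_assoc, hf.eq]
      _ = b * (f - f * f) := by rw [← hb]; noncomm_ring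
      _ = 0 := by rw [hf.eq, sub_self, mul_zero]
  · rw [codisjoint_iff, Ideal.eq_top_iff_one]
    have h := Submodule.add_mem_sup (Ideal.mem_span_singleton_self f)
      (Ideal.mem_span_singleton_self (1 - f))
    rwa [add_sub_cancel] at h

/-- Write `1 = f + f'` along the decomposition; right multiplication by `f` is the projection onto
`D`. -/
theorem exists_eq_span_singleton_of_isComplemented {D : Ideal R} (hD : IsComplemented D) :
    ∃ f : R, IsIdempotentElem f ∧ D = Ideal.span {f} := by
  obtain ⟨D', hD'⟩ := hD
  have h1 : (1 : R) ∈ D ⊔ D' := by rw [hD'.sup_eq_top]; trivial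
  obtain ⟨f, hf, f', hf', hff'⟩ := Submodule.mem_sup.1 h1
  have key : ∀ d ∈ D, d * f = d := by
    intro d hd
    have h : d - d * f = d * f' := by rw [← sub_eq_iff_eq_add'.2 hff'.symm]; noncomm_ring
    have h0 : d - d * f = 0 :=
      Submodule.disjoint_def.1 hD'.disjoint _ (D.sub_mem hd (D.mul_mem_left d hf))
        (h ▸ D'.mul_mem_left d hf')
    exact (sub_eq_zero.1 h0).symm
  refine ⟨f, key f hf, le_antisymm (fun d hd => Ideal.mem_span_singleton'.2 ⟨d, key d hd⟩) ?_⟩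
  rwa [Ideal.span_le, Set.singleton_subset_iff]

/-- An idempotent of a left ideal that does not generate it can be strictly enlarged in it. -/
theorem exists_idempotent_gt (hR : HasIdempotentMultiples R) {I : Ideal R}
    (hI : ¬ IsComplemented I) {f : R} (hf : IsIdempotentElem f) (hfI : f ∈ I) :
    ∃ k : R, (IsIdempotentElem k ∧ k ∈ I) ∧ f * k = f ∧ k * f = f ∧ k ≠ f := by
  obtain ⟨x, hxI, hx⟩ : ∃ x ∈ I, x - x * f ≠ 0 := by
    by_contra! h
    refine hI ?_
    have : I = Ideal.span {f} :=
      le_antisymm (fun d hd => Ideal.mem_span_singleton'.2 ⟨d, (sub_eq_zero.1 (h d hd)).symm⟩)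
        (by rwa [Ideal.span_le, Set.singleton_subset_iff])
    exact this ▸ isComplemented_span_singleton hf
  obtain ⟨z, hg, hg0⟩ := hR _ hx
  have hgI : z * (x - x * f) ∈ I :=
    I.mul_mem_left _ (I.sub_mem hxI (I.mul_mem_left _ hfI))
  have hgf : z * (x - x * f) * f = 0 := by
    rw [mul_assoc, sub_mul, mul_assoc x, hf.eq, sub_self, mul_zero]
  generalize z * (x - x * f) = g at hg hg0 hgI hgf
  have hf' := hf.eq
  have hg' := hg.eq
  -- Since `g * f = 0`, the correction `g - f * g` is an idempotent orthogonal to `f` on both sides.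
  refine ⟨f + (g - f * g), ⟨?_, I.add_mem hfI (I.sub_mem hgI (I.mul_mem_left _ hgI))⟩, ?_, ?_, ?_⟩
  · change (f + (g - f * g)) * (f + (g - f * g)) = _
    have e1 : f * (g - f * g) = 0 := by rw [mul_sub, ← mul_assoc, hf', sub_self]
    have e2 : (g - f * g) * f = 0 := by rw [sub_mul, mul_assoc, hgf, mul_zero, sub_zero]
    have e3 : (g - f * g) * g = g - f * g := by rw [sub_mul, mul_assoc, hg']
    have e4 : (g - f * g) * (g - f * g) = g - f * g := by
      rw [mul_sub, ← mul_assoc, e2, zero_mul, sub_zero, e3]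
    rw [add_mul, mul_add, mul_add, e1, e2, e4, hf', add_zero, zero_add]
  · rw [mul_add, mul_sub, ← mul_assoc, hf', sub_self, add_zero]
  · rw [add_mul, sub_mul, mul_assoc f, hgf, hf', mul_zero, sub_zero, add_zero]
  · intro h
    have h0 : g - f * g = 0 := by simpa using h
    apply hg0
    calc g = g * (g - f * g) := by rw [mul_sub, ← mul_assoc, hgf, zero_mul, sub_zero, hg']
      _ = 0 := by rw [h0, mul_zero]

/-- Inside a left ideal that is not a summand, idempotents can be enlarged strictly forever,
starting from `0`; consecutive differences are orthogonal. -/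
theorem exists_orthogonalIdempotents (hR : HasIdempotentMultiples R) (hss : ¬ IsSemisimpleRing R) :
    ∃ e : ℕ → R, OrthogonalIdempotents e ∧ ∀ n, e n ≠ 0 := by
  obtain ⟨I, hI⟩ : ∃ I : Ideal R, ¬ IsComplemented I := by
    by_contra! h
    exact hss ((isSemisimpleModule_iff R R).2 ⟨h⟩)
  choose! k hk hk1 hk2 hk3 using
    fun (f : R) (hf : IsIdempotentElem f ∧ f ∈ I) => exists_idempotent_gt hR hI hf.1 hf.2
  let F : ℕ → R := fun n => k^[n] 0
  have hF : ∀ n, IsIdempotentElem (F n) ∧ F n ∈ I := by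
    intro n
    induction n with
    | zero => exact ⟨.zero, I.zero_mem⟩
    | succ n ih =>
      simp only [F, Function.iterate_succ_apply']
      exact hk _ ih
  have hs : ∀ n, F (n + 1) = k (F n) := fun n => Function.iterate_succ_apply' k n 0
  have hle : ∀ m n, m ≤ n → F m * F n = F m ∧ F n * F m = F m := by
    intro m n hmn
    induction n, hmn using Nat.le_induction with
    | base => exact ⟨(hF m).1, (hF m).1⟩
    | succ n _ ih =>
      have a := hk1 _ (hF n)
      have b := hk2 _ (hF n)
      rw [← hs] at a b
      constructor
      · rw [← ih.1, mul_assoc, a]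
      · rw [← ih.2, ← mul_assoc, b]
  refine ⟨fun n => F (n + 1) - F n, ⟨fun n => ?_, ?_⟩, fun n h => ?_⟩
  · have h := hle n (n + 1) n.le_succ
    change (F (n + 1) - F n) * (F (n + 1) - F n) = _
    rw [sub_mul, mul_sub, mul_sub, h.1, h.2, (hF n).1.eq, (hF (n + 1)).1.eq]
    abel
  · intro m n hmn
    rcases lt_or_gt_of_ne hmn with h | h
    · rw [sub_mul, mul_sub, mul_sub, (hle (m + 1) (n + 1) (by omega)).1,
        (hle (m + 1) n (by omega)).1, (hle m (n + 1) (by omega)).1, (hle m n (by omega)).1]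
      abel
    · rw [sub_mul, mul_sub, mul_sub, (hle (n + 1) (m + 1) (by omega)).2,
        (hle (n + 1) m (by omega)).2, (hle n (m + 1) (by omega)).2, (hle n m (by omega)).2]
      abel
  · exact hk3 _ (hF n) (by rw [← hs]; exact sub_eq_zero.1 h)

/-- If the subsets of every infinite family of nonzero orthogonal idempotents are separated by
idempotents, then a ring with countably many idempotents is semisimple. -/
theorem isSemisimpleRing_of_countable_idempotents (hR : HasIdempotentMultiples R)
    (hc : {e : R | IsIdempotentElem e}.Countable)
    (hsep : ∀ e : ℕ → R, OrthogonalIdempotents e → (∀ n, e n ≠ 0) →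
      ∃ f : Set ℕ → R, (∀ S, IsIdempotentElem (f S)) ∧
        ∀ S T i, i ∈ S → i ∉ T → f S ≠ f T) :
    IsSemisimpleRing R := by
  by_contra hss
  obtain ⟨e, he, he0⟩ := exists_orthogonalIdempotents hR hss
  obtain ⟨f, hf, hne⟩ := hsep e he he0
  have hinj : Function.Injective f := by
    intro S T hST
    ext i
    by_contra h
    rcases not_iff.1 h with h
    by_cases hi : i ∈ S
    · exact hne S T i hi (fun hT => h.2 hT hi) hST
    · exact hne T S i (h.1 hi) hi hST.symm
  have : Countable {e : R | IsIdempotentElem e} := hc.to_subtype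
  have hcount : Countable (Set ℕ) :=
    Function.Injective.countable (f := fun S => (⟨f S, hf S⟩ : {e : R | IsIdempotentElem e}))
      fun S T h => hinj (congrArg Subtype.val h)
  obtain ⟨φ, hφ⟩ := exists_injective_nat (Set ℕ)
  exact Function.cantor_injective φ hφ

end Idempotents

/-! ### Right strongly exchange rings with zero Jacobson radical. -/

section Exchange

variable {R : Type u} [Ring R]

theorem principalRightIdeal_le {a b : R} :
    principalRightIdeal a ≤ principalRightIdeal b ↔ ∃ r, a = b * r := by
  rw [← mem_principalRightIdeal, principalRightIdeal, Submodule.span_le, Set.singleton_subset_iff,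
    SetLike.mem_coe]

theorem principalRightIdeal_sup_eq_top {a b : R} :
    principalRightIdeal a ⊔ principalRightIdeal b = ⊤ ↔ ∃ u v, a * u + b * v = 1 := by
  constructor
  · intro h
    have h1 : (1 : R) ∈ principalRightIdeal a ⊔ principalRightIdeal b := by rw [h]; trivial
    obtain ⟨x, hx, y, hy, hxy⟩ := Submodule.mem_sup.1 h1
    obtain ⟨u, rfl⟩ := mem_principalRightIdeal.1 hx
    obtain ⟨v, rfl⟩ := mem_principalRightIdeal.1 hy
    exact ⟨u, v, hxy⟩
  · rintro ⟨u, v, h⟩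
    rw [eq_top_iff]
    intro x _
    refine Submodule.mem_sup.2 ⟨a * (u * x), mem_principalRightIdeal.2 ⟨_, rfl⟩,
      b * (v * x), mem_principalRightIdeal.2 ⟨_, rfl⟩, ?_⟩
    rw [← mul_assoc, ← mul_assoc, ← add_mul, h, one_mul]

/-- The Jacobson radical contains every `x` for which all `1 + x * r` are right invertible. -/
theorem mem_jacobson_of_forall_right_inverse {x : R} (h : ∀ r, ∃ w, (1 + x * r) * w = 1) :
    x ∈ Ring.jacobson R := by
  rw [← Ideal.jacobson_bot, Ideal.mem_jacobson_iff]
  intro y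
  obtain ⟨w, hw⟩ := h y
  -- The right inverse `w` of `1 + x * y` is again of the form `1 + x * r`, so it is right
  -- invertible too and hence a two-sided inverse.
  obtain ⟨w', hw'⟩ := h (-(y * w))
  have hw1 : 1 + x * -(y * w) = w := by
    rw [mul_neg, ← sub_eq_add_neg, sub_eq_iff_eq_add', ← hw]; noncomm_ring
  rw [hw1] at hw'
  have hw2 : w' = 1 + x * y := by
    calc w' = (1 + x * y) * w * w' := by rw [hw, one_mul]
      _ = 1 + x * y := by rw [mul_assoc, hw', mul_one]
  rw [hw2] at hw'
  -- The usual passage from an inverse of `1 + x * y` to a left inverse of `1 + y * x`.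
  refine ⟨1 - y * w * x, ?_⟩
  rw [Submodule.mem_bot]
  have h3 : w * (x * y) = 1 - w := by rw [← hw']; noncomm_ring
  calc (1 - y * w * x) * y * x + (1 - y * w * x) - 1
      = y * x - y * (w * (x * y)) * x - y * w * x := by noncomm_ring
    _ = 0 := by rw [h3]; noncomm_ring

/-- Minimality of `⟨a, b⟩` forces `aR ∩ bR` into the radical. For `c` in the intersection, replacing
`a` by `(1 + c * r) * a` gives a smaller coprime pair, because `c * r * a ∈ bR`; by minimality `a ∈
(1 + c * r) * aR`, which makes `1 + c * r` right invertible. So `R = aR ⊕ bR`. -/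
theorem exists_idempotent_of_isMin (hJ : Ring.jacobson R = ⊥) {g : RightCoprimeGenerators R}
    (hg : IsMin g.toPair) :
    ∃ f, IsIdempotentElem f ∧ f ∈ principalRightIdeal g.fst ∧ 1 - f ∈ principalRightIdeal g.snd := by
  obtain ⟨u, v, huv⟩ := principalRightIdeal_sup_eq_top.1 g.sup_eq_top
  have hdisj : ∀ s t, g.fst * s = g.snd * t → g.fst * s = 0 := by
    intro s t hst
    rw [← Submodule.mem_bot R, ← hJ]
    refine mem_jacobson_of_forall_right_inverse fun r => ?_
    let g' : RightCoprimeGenerators R :=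
      ⟨g.fst + g.fst * s * (r * g.fst), g.snd, principalRightIdeal_sup_eq_top.2
        ⟨u, v - t * (r * g.fst) * u, by rw [hst, ← huv]; noncomm_ring⟩⟩
    have hle : g'.toPair ≤ g.toPair := by
      rw [RightCoprimeGenerators.toPair_le_toPair]
      exact ⟨principalRightIdeal_le.2 ⟨1 + s * (r * g.fst), by simp only [g']; noncomm_ring⟩, le_rfl⟩
    obtain ⟨y, hy⟩ := principalRightIdeal_le.1
      ((RightCoprimeGenerators.toPair_le_toPair _ _).1 (hg hle)).1
    refine ⟨1 - g.fst * y * s * r, ?_⟩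
    have hy' : (1 + g.fst * s * r) * (g.fst * y) = g.fst := by
      conv_rhs => rw [hy]
      simp only [g']; noncomm_ring
    calc (1 + g.fst * s * r) * (1 - g.fst * y * s * r)
        = 1 + g.fst * s * r - (1 + g.fst * s * r) * (g.fst * y) * s * r := by noncomm_ring
      _ = 1 := by rw [hy']; noncomm_ring
  refine ⟨g.fst * u, ?_, mem_principalRightIdeal.2 ⟨_, rfl⟩,
    mem_principalRightIdeal.2 ⟨v, by rw [← huv]; abel⟩⟩
  -- With `p = a * u`, the element `p - p * p = (1 - p) * p` lies in both `aR` and `bR`.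
  have h := hdisj (u - u * (g.fst * u)) (v * (g.fst * u)) (by
    calc g.fst * (u - u * (g.fst * u)) = (1 - g.fst * u) * (g.fst * u) := by noncomm_ring
      _ = g.snd * (v * (g.fst * u)) := by rw [← huv]; noncomm_ring)
  rw [mul_sub, ← mul_assoc, sub_eq_zero] at h
  exact h.symm

/-- In a right strongly exchange ring with zero Jacobson radical, a descending sequence of coprime
pairs with compatible transition elements lies above a decomposition `R = fR ⊕ (1 - f)R`. -/
theorem IsRightStronglyExchange.exists_idempotent (hR : IsRightStronglyExchange R)
    (hJ : Ring.jacobson R = ⊥) (a b : ℕ → R) (r s : ℕ → ℕ → R)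
    (hab : ∀ n, ∃ u v, a n * u + b n * v = 1)
    (hr : ∀ m n, m < n → a n = a m * r m n ∧ b n = b m * s m n)
    (hrs : ∀ m k n, m < k → k < n → r m n = r m k * r k n ∧ s m n = s m k * s k n) :
    ∃ f, IsIdempotentElem f ∧ (∀ n, ∃ x, f = a n * x) ∧ ∀ n, ∃ y, 1 - f = b n * y := by
  -- Chains are indexed by ordinals; `N` identifies the ordinals below `ω` with natural numbers.
  choose N hN using fun α : Set.Iio (Ordinal.omega0.{u}) => Ordinal.lt_omega0.1 α.2
  have hNlt : ∀ {α β}, α < β → N α < N β := by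
    intro α β h
    have h' : α.1 < β.1 := h
    rw [hN α, hN β] at h'
    exact_mod_cast h'
  let G : ℕ → RightCoprimeGenerators R :=
    fun n => ⟨a n, b n, principalRightIdeal_sup_eq_top.2 (hab n)⟩
  have hG : ∀ m n, m ≤ n → (G n).toPair ≤ (G m).toPair := by
    intro m n h
    rcases h.eq_or_lt with rfl | h
    · exact le_rfl
    · rw [RightCoprimeGenerators.toPair_le_toPair]
      exact ⟨principalRightIdeal_le.2 ⟨_, (hr m n h).1⟩, principalRightIdeal_le.2 ⟨_, (hr m n h).2⟩⟩
  obtain ⟨q, hq, hmin⟩ := hR Ordinal.omega0 (fun α => (G (N α)).toPair) (by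
    refine ⟨fun α β h => ?_, fun α => G (N α), fun α β => r (N α) (N β), fun α β => s (N α) (N β),
      fun _ => rfl, fun α β h => hr _ _ (hNlt h), fun α γ β h h' => hrs _ _ _ (hNlt h) (hNlt h')⟩
    rcases h.eq_or_lt with rfl | h
    · exact le_rfl
    · exact hG _ _ (hNlt h).le)
  obtain ⟨g, rfl⟩ : ∃ g : RightCoprimeGenerators R, g.toPair = q :=
    Quotient.inductionOn' q fun g => ⟨g, rfl⟩
  obtain ⟨f, hf, hf1, hf2⟩ := exists_idempotent_of_isMin hJ hmin
  have hle : ∀ n, g.toPair ≤ (G n).toPair := by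
    intro n
    have h : g.toPair ≤ (G (N ⟨n, Ordinal.natCast_lt_omega0 n⟩)).toPair := hq ⟨_, rfl⟩
    have hn : n = N ⟨n, Ordinal.natCast_lt_omega0 n⟩ := by
      exact Nat.cast_injective (hN ⟨n, Ordinal.natCast_lt_omega0 n⟩)
    rwa [← hn] at h
  have hle' := fun n => (RightCoprimeGenerators.toPair_le_toPair _ _).1 (hle n)
  exact ⟨f, hf, fun n => mem_principalRightIdeal.1 ((hle' n).1 hf1),
    fun n => mem_principalRightIdeal.1 ((hle' n).2 hf2)⟩

/-- As `x` is not in the radical, some `1 + x * r` has no right inverse. The constant chain at `⟨x *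
r, 1 + x * r⟩` then yields an idempotent `f ∈ xR`, nonzero because otherwise `1 ∈ (1 + x * r)R`. -/
theorem IsRightStronglyExchange.hasIdempotentMultiples (hR : IsRightStronglyExchange R)
    (hJ : Ring.jacobson R = ⊥) : HasIdempotentMultiples R := by
  intro x hx
  obtain ⟨r, hr⟩ : ∃ r, ∀ w, (1 + x * r) * w ≠ 1 := by
    by_contra! h
    have := mem_jacobson_of_forall_right_inverse h
    rw [hJ, Submodule.mem_bot] at this
    exact hx this
  obtain ⟨f, hf, hf1, hf2⟩ := hR.exists_idempotent hJ (fun _ => x * r) (fun _ => 1 + x * r)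
    (fun _ _ => 1) (fun _ _ => 1) (fun _ => ⟨-1, 1, by noncomm_ring⟩)
    (fun _ _ _ => ⟨(mul_one _).symm, (mul_one _).symm⟩)
    (fun _ _ _ _ _ => ⟨(mul_one _).symm, (mul_one _).symm⟩)
  obtain ⟨y, hy⟩ := hf1 0
  obtain ⟨w, hw⟩ := hf2 0
  have hf0 : f ≠ 0 := by
    rintro rfl
    exact hr w (by rw [← hw, sub_zero])
  have hfx : x * (r * y) = f := by rw [hy, mul_assoc]
  -- From `f = x * (r * y)`, the idempotent right multiple of `x` is turned into a left multiple `r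
  -- * y * f * x`.
  refine ⟨r * y * f, ?_, fun h => hf0 ?_⟩
  · calc r * y * f * x * (r * y * f * x) = r * y * (f * (x * (r * y)) * f) * x := by noncomm_ring
      _ = r * y * f * x := by rw [hfx, hf.eq, hf.eq]
  · calc f = x * (r * y) * f * (x * (r * y)) := by rw [hfx, hf.eq, hf.eq]
      _ = x * (r * y * f * x) * (r * y) := by noncomm_ring
      _ = 0 := by rw [h, mul_zero, zero_mul]

theorem OrthogonalIdempotents.sum_mul_sum {ι : Type*} {e : ι → R} (he : OrthogonalIdempotents e)
    [DecidableEq ι] (s t : Finset ι) :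
    (∑ i ∈ s, e i) * ∑ i ∈ t, e i = ∑ i ∈ s ∩ t, e i := by
  simp [Finset.sum_mul, Finset.mul_sum, he.mul_eq, Finset.sum_ite_mem, Finset.inter_comm]

/-- The idempotents `a n` and `b n` remove the `e i` with `i < n` outside `S` and inside `S`
respectively. A decomposition below all these pairs has `f ∈ a n R` and `1 - f ∈ b n R`, so `f` is
killed by `e i` for `i ∉ S`, and `1 - f` for `i ∈ S`. -/
theorem IsRightStronglyExchange.exists_separating_idempotent (hR : IsRightStronglyExchange R)
    (hJ : Ring.jacobson R = ⊥) {e : ℕ → R} (he : OrthogonalIdempotents e) (S : Set ℕ) :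
    ∃ f, IsIdempotentElem f ∧ (∀ i ∈ S, e i * f = e i) ∧ ∀ i ∉ S, e i * f = 0 := by
  classical
  let A (n : ℕ) : Finset ℕ := {i ∈ Finset.range n | i ∉ S}
  let B (n : ℕ) : Finset ℕ := {i ∈ Finset.range n | i ∈ S}
  let a (n : ℕ) : R := 1 - ∑ i ∈ A n, e i
  let b (n : ℕ) : R := 1 - ∑ i ∈ B n, e i
  have mul_sub_sum : ∀ s t : Finset ℕ, s ⊆ t →
      1 - ∑ i ∈ t, e i = (1 - ∑ i ∈ s, e i) * (1 - ∑ i ∈ t, e i) := by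
    intro s t h
    rw [mul_sub, sub_mul _ _ (∑ i ∈ t, e i), he.sum_mul_sum, Finset.inter_eq_left.2 h]
    noncomm_ring
  have hA : ∀ m n, m ≤ n → a n = a m * a n := fun m n h =>
    mul_sub_sum _ _ (Finset.filter_subset_filter _ (Finset.range_mono h))
  have hB : ∀ m n, m ≤ n → b n = b m * b n := fun m n h =>
    mul_sub_sum _ _ (Finset.filter_subset_filter _ (Finset.range_mono h))
  -- Since `a m * a n = a n` for `m ≤ n`, the element `a n` serves as its own transition element
  -- from every `m`; likewise `b n`.
  obtain ⟨f, hf, hf1, hf2⟩ := hR.exists_idempotent hJ a b (fun _ n => a n) (fun _ n => b n)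
    (fun n => by
      refine ⟨∑ i ∈ B n, e i, 1, ?_⟩
      have hAB : A n ∩ B n = ∅ := by
        ext i
        simp only [A, B, Finset.mem_inter, Finset.mem_filter, Finset.notMem_empty]
        tauto
      simp only [a, b]
      rw [sub_mul, he.sum_mul_sum, hAB, Finset.sum_empty]
      noncomm_ring)
    (fun m n h => ⟨hA m n h.le, hB m n h.le⟩)
    (fun m k n _ h => ⟨hA k n h.le, hB k n h.le⟩)
  refine ⟨f, hf, fun i hi => ?_, fun i hi => ?_⟩
  · obtain ⟨y, hy⟩ := hf2 (i + 1)
    have h : e i * (1 - f) = 0 := by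
      rw [hy, ← mul_assoc]
      simp only [b]
      rw [mul_sub, mul_one, he.mul_sum_of_mem (by simp [B, hi]), sub_self, zero_mul]
    rw [mul_sub, mul_one, sub_eq_zero] at h
    exact h.symm
  · obtain ⟨x, hx⟩ := hf1 (i + 1)
    rw [hx, ← mul_assoc]
    simp only [a]
    rw [mul_sub, mul_one, he.mul_sum_of_mem (by simp [A, hi]), sub_self, zero_mul]

end Exchange

/-! ### Von Neumann regular, left continuous rings. -/

section Continuous

variable {R : Type u} [Ring R]

theorem IsVonNeumannRegularRing.hasIdempotentMultiples (hR : IsVonNeumannRegularRing R) :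
    HasIdempotentMultiples R := by
  intro a ha
  obtain ⟨x, hx⟩ := hR a
  refine ⟨x, ?_, fun h => ha ?_⟩
  · change x * a * (x * a) = x * a
    rw [mul_assoc, ← mul_assoc a, hx]
  · rw [← hx, mul_assoc, h, mul_zero]

/-- The closure of a sum of orthogonal left ideals `R e_i` determines the indices `i`. -/
theorem mem_of_isEssentialIn_span {e : ℕ → R} (he : OrthogonalIdempotents e) {S T : Set ℕ}
    {D : Ideal R} (hS : IsEssentialIn (Ideal.span (e '' S)) D)
    (hT : IsEssentialIn (Ideal.span (e '' T)) D) {i : ℕ} (hi : i ∈ S) (hei : e i ≠ 0) :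
    i ∈ T := by
  by_contra hiT
  have hle : Ideal.span {e i} ≤ D :=
    (Ideal.span_mono (Set.singleton_subset_iff.2 (Set.mem_image_of_mem e hi))).trans hS.1
  have hbot : Ideal.span (e '' T) ⊓ Ideal.span {e i} = ⊥ := by
    rw [eq_bot_iff]
    rintro x ⟨hxT, hxi⟩
    obtain ⟨c, rfl⟩ := Ideal.mem_span_singleton'.1 hxi
    -- Right multiplication by `e i` kills the `T`-sum but fixes `R e_i`, so the two meet in zero,
    -- against essentiality.
    have hz : ∀ y ∈ Ideal.span (e '' T), y * e i = 0 := by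
      intro y hy
      induction hy using Submodule.span_induction with
      | mem y hy =>
        obtain ⟨j, hj, rfl⟩ := hy
        exact he.ortho fun h => hiT (h ▸ hj)
      | zero => exact zero_mul _
      | add y z _ _ hy hz => rw [add_mul, hy, hz, add_zero]
      | smul r y _ hy => rw [smul_eq_mul, mul_assoc, hy, mul_zero]
    have := hz _ hxT
    rwa [mul_assoc, (he.idem i).eq] at this
  exact hei (Ideal.span_singleton_eq_bot.1 (hT.2 _ hle hbot))

end Continuous

theorem mainTheorem6 (R : Type u) [Ring R] :
    (IsRightStronglyExchange R → {e : R | IsIdempotentElem e}.Countable →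
      Ring.jacobson R = ⊥ → IsSemisimpleRing R) ∧
    (IsVonNeumannRegularRing R → IsLeftContinuousRing R →
      {e : R | IsIdempotentElem e}.Countable → IsSemisimpleRing R) := by
  constructor
  · intro hR hc hJ
    refine isSemisimpleRing_of_countable_idempotents (hR.hasIdempotentMultiples hJ) hc ?_
    intro e he he0
    choose f hf hf1 hf2 using hR.exists_separating_idempotent hJ he
    refine ⟨f, hf, fun S T i hS hT h => he0 i ?_⟩
    rw [← hf1 S i hS, h, hf2 T i hT]
  · intro hR hcont hc
    refine isSemisimpleRing_of_countable_idempotents hR.hasIdempotentMultiples hc ?_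
    intro e he he0
    have hex : ∀ S : Set ℕ, ∃ f, IsIdempotentElem f ∧
        IsEssentialIn (Ideal.span (e '' S)) (Ideal.span {f}) := by
      intro S
      obtain ⟨D, hD, hSD⟩ := hcont.c1 (Ideal.span (e '' S))
      obtain ⟨f, hf, rfl⟩ := exists_eq_span_singleton_of_isComplemented hD
      exact ⟨f, hf, hSD⟩
    choose f hf hess using hex
    refine ⟨f, hf, fun S T i hS hT h => hT ?_⟩
    exact mem_of_isEssentialIn_span he (hess S) (h ▸ hess T) hS (he0 i)
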